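/- **Notation.** Let $a_1,\dots,a_p$ be strictly positive integers and $m\ge\max(a_1,\dots,a_p)$ an integer. Let $\mathcal F_p$ be the free real Lie algebra on $p$ generators $Y_1,\dots,Y_p$; for $r>0$ let $\Phi_r$ be the endomorphism of $\mathcal F_p$ with $\Phi_r(Y_j)=r^{a_j}Y_j$, and let $\mathcal F_p^\ell=\{Y\in\mathcal F_p:\Phi_r(Y)=r^\ell Y\text{ for all }r>0\}$. Put $\mathcal I^m=\bigoplus_{\ell>m}\mathcal F_p^\ell$, which is a Lie ideal, and $\mathcal N_m^{a_1,\dots,a_p}=\mathcal F_p/\mathcal I^m$. For vector fields $X_1,\dots,X_p$ and a nonempty finite sequence $I=(i_1,\dots,i_k)$ with entries in $\{1,\dots,p\}$, let $X_I=[X_{i_1},[X_{i_2},\dots,[X_{i_{k-1}},X_{i_k}]\dots]]$ (so that $X_{(i)}=X_i$) and $|I|=a_{i_1}+\dots+a_{i_k}$. Smooth real vector fields $X_1,\dots,X_p$ on an open subset $U$ of $\mathbb R^d$ are called *free relative to the exponents $a_1,\dots,a_p$ and the order $m$* if $d=\dim\mathcal N_m^{a_1,\dots,a_p}$ and, for every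 $u\in U$, the vectors $X_I(u)$ with $|I|\le m$ span the tangent space of $\mathbb R^d$ at $u$. **Proposition 6.1.** Let $O$ be an open neighborhood of the origin in $\mathbb R^n$, and let $$X_i=\sum_{j=1}^n a_i^j(x)\frac{\partial}{\partial x_j},\qquad i=1,\dots,p,$$ be smooth real vector fields on $O$ such that for every $x\in O$ the vectors $X_I(x)$ with $|I|\le m$ span the tangent space of $\mathbb R^n$ at $x$. Let $d=\dim\mathcal N_m^{a_1,\dots,a_p}$. Then $n\le d$, and, writing the points of $\mathbb R^d=\mathbb R^n\times\mathbb R^{d-n}$ as $(x,z)$, there are an open neighborhood $U\subset O\times\mathbb R^{d-n}$ of the origin in $\mathbb R^d$ and smooth real functions $b_i^k$ on $U$ ($1\le i\le p$, $1\le k\le d-n$) such that the vector fields $$\tilde X_i=\sum_{j=1}^n a_i^j(x)\frac{\partial}{\partial x_j}+\sum_{k=1}^{d-n}b_i^k(x,z)\frac{\partial}{\partial z_k},\qquad i=1,\dots,p,$$ are free relative to the exponents $a_1,\dots,a_p$ and the order $m$ on $U$. -/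

import Mathlib

open scoped ContDiff

/-! ### The relatively free nilpotent Lie algebra -/

/-- The dilation `Φ_r` of the free Lie algebra on `p` generators: the Lie algebra endomorphism
that multiplies the `j`-th generator by `r ^ a j`. -/
noncomputable def freeDilation {p : ℕ} (a : Fin p → ℕ) (r : ℝ) :
    FreeLieAlgebra ℝ (Fin p) →ₗ⁅ℝ⁆ FreeLieAlgebra ℝ (Fin p) :=
  FreeLieAlgebra.lift ℝ fun j => r ^ a j • FreeLieAlgebra.of ℝ j

/-- The subspace of all elements of the free Lie algebra that are homogeneous of degree `l`
under the dilations `Φ_r`, `r > 0`. -/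
noncomputable def freeHomogeneous {p : ℕ} (a : Fin p → ℕ) (l : ℕ) :
    Submodule ℝ (FreeLieAlgebra ℝ (Fin p)) where
  carrier := {x | ∀ r : ℝ, 0 < r → freeDilation a r x = r ^ l • x}
  zero_mem' := fun r _ => by simp
  add_mem' := fun hx hy r hr => by rw [map_add, hx r hr, hy r hr, smul_add]
  smul_mem' := fun c x hx r hr => by rw [map_smul, hx r hr, smul_comm]

/-- The sum of the homogeneous subspaces of degree greater than `m`. -/
noncomputable def freeTail {p : ℕ} (a : Fin p → ℕ) (m : ℕ) :
    Submodule ℝ (FreeLieAlgebra ℝ (Fin p)) :=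
  ⨆ l : ℕ, ⨆ _ : m < l, freeHomogeneous a l

theorem of_lie_mem_freeTail {p : ℕ} (a : Fin p → ℕ) (m : ℕ) (j : Fin p)
    {y : FreeLieAlgebra ℝ (Fin p)} (hy : y ∈ freeTail a m) :
    ⁅FreeLieAlgebra.of ℝ j, y⁆ ∈ freeTail a m := by
  have key : freeTail a m ≤
      (freeTail a m).comap (LieAlgebra.ad ℝ (FreeLieAlgebra ℝ (Fin p))
        (FreeLieAlgebra.of ℝ j) : FreeLieAlgebra ℝ (Fin p) →ₗ[ℝ] FreeLieAlgebra ℝ (Fin p)) := by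
    refine iSup₂_le fun l hl z hz => ?_
    rw [Submodule.mem_comap, LieAlgebra.ad_apply]
    have h1 : ⁅FreeLieAlgebra.of ℝ j, z⁆ ∈ freeHomogeneous a (a j + l) := by
      intro r hr
      have h2 : freeDilation a r (FreeLieAlgebra.of ℝ j) = r ^ a j • FreeLieAlgebra.of ℝ j := by
        simp [freeDilation]
      rw [LieHom.map_lie, hz r hr, h2, smul_lie, lie_smul, smul_smul, pow_add]
    exact (le_iSup₂_of_le (f := fun (l : ℕ) (_ : m < l) => freeHomogeneous a l)
      (a j + l) (by omega) le_rfl) h1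
  exact key hy

/-- The Lie ideal `I^m`, the sum of the homogeneous subspaces of degree greater than `m`. -/
noncomputable def freeTailIdeal {p : ℕ} (a : Fin p → ℕ) (m : ℕ) :
    LieIdeal ℝ (FreeLieAlgebra ℝ (Fin p)) where
  toSubmodule := freeTail a m
  lie_mem := by
    intro x y hy
    -- The elements whose bracket preserves `freeTail a m` form a subalgebra with all generators.
    let K : LieSubalgebra ℝ (FreeLieAlgebra ℝ (Fin p)) :=
      { carrier := {x | ∀ y ∈ freeTail a m, ⁅x, y⁆ ∈ freeTail a m}
        zero_mem' := fun y _ => by simp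
        add_mem' := fun hx hx' y hy => by
          rw [add_lie]; exact Submodule.add_mem _ (hx y hy) (hx' y hy)
        smul_mem' := fun c x hx y hy => by
          rw [smul_lie]; exact Submodule.smul_mem _ c (hx y hy)
        lie_mem' := fun {u v} hu hv y hy => by
          rw [lie_lie]
          exact Submodule.sub_mem _ (hu _ (hv y hy)) (hv _ (hu y hy)) }
    let g : FreeLieAlgebra ℝ (Fin p) →ₗ⁅ℝ⁆ K :=
      FreeLieAlgebra.lift ℝ fun j =>
        ⟨FreeLieAlgebra.of ℝ j, fun _ hy => of_lie_mem_freeTail a m j hy⟩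
    have hg : K.incl.comp g = LieHom.id := by
      apply FreeLieAlgebra.hom_ext
      intro j
      simp [g]
    have hx : K.incl (g x) = x := by
      have := congrArg (fun f : FreeLieAlgebra ℝ (Fin p) →ₗ⁅ℝ⁆ FreeLieAlgebra ℝ (Fin p) => f x) hg
      simpa using this
    have hK : x ∈ K := hx ▸ (g x).2
    exact hK y hy

/-- The relatively free nilpotent Lie algebra `𝒩_m^{a_1, …, a_p}` of order `m`. -/
abbrev RelFreeNilpotent {p : ℕ} (a : Fin p → ℕ) (m : ℕ) : Type :=
  FreeLieAlgebra ℝ (Fin p) ⧸ freeTailIdeal a m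

/-! ### Commutators of vector fields -/

/-- The iterated commutator `X_I = [X_{i_1}, [X_{i_2}, … [X_{i_{k-1}}, X_{i_k}] … ]]` of vector
fields, for `I = [i_1, …, i_k]`; the value at the empty list is irrelevant. -/
noncomputable def iteratedCommutator {E : Type*} [NormedAddCommGroup E] [NormedSpace ℝ E] {p : ℕ}
    (X : Fin p → E → E) : List (Fin p) → E → E
  | [] => 0
  | [i] => X i
  | i :: j :: I => VectorField.lieBracket ℝ (X i) (iteratedCommutator X (j :: I))

/-- The degree `|I| = a_{i_1} + ⋯ + a_{i_k}` of `I = [i_1, …, i_k]`. -/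
def weightedDegree {p : ℕ} (a : Fin p → ℕ) (I : List (Fin p)) : ℕ :=
  (I.map a).sum

/-- The commutators `X_I` of degree `|I| ≤ m` span the tangent space at each point of `O`. -/
def CommutatorsSpan {E : Type*} [NormedAddCommGroup E] [NormedSpace ℝ E] {p : ℕ}
    (a : Fin p → ℕ) (m : ℕ) (X : Fin p → E → E) (O : Set E) : Prop :=
  ∀ x ∈ O, Submodule.span ℝ
    {v : E | ∃ I : List (Fin p), I ≠ [] ∧ weightedDegree a I ≤ m ∧ v = iteratedCommutator X I x} = ⊤

/-- The vector fields `X_1, …, X_p`, smooth on the open set `O`, are free relative to the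
exponents `a_1, …, a_p` and the order `m`: the dimension of the ambient space is that of
`𝒩_m^{a_1, …, a_p}`, and the commutators of degree at most `m` span the tangent space at each
point of `O`. -/
structure IsFreeVectorFields {E : Type*} [NormedAddCommGroup E] [NormedSpace ℝ E] {p : ℕ}
    (a : Fin p → ℕ) (m : ℕ) (X : Fin p → E → E) (O : Set E) : Prop where
  isOpen : IsOpen O
  smooth : ∀ i, ContDiffOn ℝ ∞ (X i) O
  finrank_eq : Module.finrank ℝ E = Module.finrank ℝ (RelFreeNilpotent a m)
  span : CommutatorsSpan a m X O

-- Evaluation at the origin is a linear map `L` from the free Lie algebra to the tangent space. The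
-- span `freeHead a m` of the right-normed brackets of weight at most `m` is a complement of the
-- tail, so it has dimension `d`. Spanning at 0 means that `L` maps it onto `ℝ^n`, hence `n ≤ d`.
-- While the dimension is too small, one variable `z` is added and `X_i` becomes `X_i + b_i(x) ∂_z`,
-- keeping the spanning property at 0 (`exists_lift_one_variable`, iterated in `exists_lift`).
--
-- To choose `b`, take the least `t` for which `L` kills some `y ≠ 0` in `freeHead a t`. Sorting by
-- last letters, `y = ∑ Q_i Y_i` in the free associative algebra, and the `∂_z`-component of `y` for
-- the new fields is `∑ Q_i(X) b_i` (`iteratedCommutator_prodMk`). It is enough that some `Q_i(X)`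
-- does not vanish at 0 as a functional on smooth functions. Some `Q_i` is nonzero by a weighted
-- Dynkin–Specht–Wever identity. Each `Q_i` is a combination of products of brackets of total weight
-- at most `t - 1`, where `L` is injective. Testing on powers of a function vanishing at 0 isolates
-- the leading symbol, and an element with vanishing symbol can be reordered into shorter products;
-- by induction on length, a nonzero `Q_i` gives a nonzero functional
-- (`eq_zero_of_eval_freeOperator_eq_zero`).
--
-- Commutators at 0 depend only on germs, so the fields may be cut off and assumed global; spanning
-- at 0 then extends to a neighborhood because linear independence is an open condition.

attribute [local instance] LieRing.ofAssociativeRing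

open FreeLieAlgebra

/-! ### Right-normed brackets in the free Lie algebra -/

namespace FreeLieAlgebra

theorem lieSubalgebra_eq_top {p : ℕ} (K : LieSubalgebra ℝ (FreeLieAlgebra ℝ (Fin p)))
    (hK : ∀ j, of ℝ j ∈ K) : K = ⊤ := by
  let g : FreeLieAlgebra ℝ (Fin p) →ₗ⁅ℝ⁆ K := lift ℝ fun j => ⟨of ℝ j, hK j⟩
  have hg : K.incl.comp g = LieHom.id := by
    apply hom_ext
    intro j
    simp [g]
  refine eq_top_iff.2 fun x _ => ?_
  have hx : K.incl (g x) = x := by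
    have := congrArg (fun f : FreeLieAlgebra ℝ (Fin p) →ₗ⁅ℝ⁆ FreeLieAlgebra ℝ (Fin p) => f x) hg
    simpa using this
  exact hx ▸ (g x).2

end FreeLieAlgebra

/-- The right-normed bracket `[Y_{i_1}, [Y_{i_2}, … Y_{i_k}]]` of generators. -/
noncomputable def freeBracket {p : ℕ} : List (Fin p) → FreeLieAlgebra ℝ (Fin p)
  | [] => 0
  | [i] => FreeLieAlgebra.of ℝ i
  | i :: j :: I => ⁅FreeLieAlgebra.of ℝ i, freeBracket (j :: I)⁆

@[elab_as_elim]
theorem List.nonempty_rec {α : Type*} {C : (I : List α) → I ≠ [] → Prop}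
    (single : ∀ i, C [i] (List.cons_ne_nil i []))
    (cons : ∀ i I (hI : I ≠ []), C I hI → C (i :: I) (List.cons_ne_nil i I))
    (I : List α) (hI : I ≠ []) : C I hI := by
  induction I with
  | nil => exact absurd rfl hI
  | cons i I ih =>
    by_cases h : I = []
    · subst h; exact single i
    · exact cons i I h (ih h)

theorem freeBracket_singleton {p : ℕ} (i : Fin p) : freeBracket [i] = of ℝ i := by
  rw [freeBracket]

theorem freeBracket_cons {p : ℕ} (i : Fin p) {I : List (Fin p)} (hI : I ≠ []) :
    freeBracket (i :: I) = ⁅of ℝ i, freeBracket I⁆ := by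
  cases I with
  | nil => exact absurd rfl hI
  | cons j J => rw [freeBracket]

theorem weightedDegree_singleton {p : ℕ} (a : Fin p → ℕ) (i : Fin p) :
    weightedDegree a [i] = a i := by simp [weightedDegree]

theorem weightedDegree_cons {p : ℕ} (a : Fin p → ℕ) (i : Fin p) (I : List (Fin p)) :
    weightedDegree a (i :: I) = a i + weightedDegree a I := by simp [weightedDegree]

theorem weightedDegree_pos {p : ℕ} {a : Fin p → ℕ} (ha : ∀ i, 0 < a i) {I : List (Fin p)}
    (hI : I ≠ []) : 0 < weightedDegree a I := by
  cases I with
  | nil => exact absurd rfl hI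
  | cons j J => rw [weightedDegree_cons]; have := ha j; omega

theorem length_le_weightedDegree {p : ℕ} {a : Fin p → ℕ} (ha : ∀ i, 0 < a i) (I : List (Fin p)) :
    I.length ≤ weightedDegree a I := by
  induction I with
  | nil => simp
  | cons j J ih => rw [weightedDegree_cons, List.length_cons]; have := ha j; omega

theorem lie_mem_freeHomogeneous {p : ℕ} {a : Fin p → ℕ} {k l : ℕ}
    {x y : FreeLieAlgebra ℝ (Fin p)} (hx : x ∈ freeHomogeneous a k)
    (hy : y ∈ freeHomogeneous a l) : ⁅x, y⁆ ∈ freeHomogeneous a (k + l) := by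
  intro r hr
  rw [LieHom.map_lie, hx r hr, hy r hr, smul_lie, lie_smul, smul_smul, pow_add]

theorem of_mem_freeHomogeneous {p : ℕ} (a : Fin p → ℕ) (i : Fin p) :
    of ℝ i ∈ freeHomogeneous a (a i) := by
  intro r _
  simp [freeDilation]

theorem freeBracket_mem_freeHomogeneous {p : ℕ} (a : Fin p → ℕ) (I : List (Fin p)) :
    freeBracket I ∈ freeHomogeneous a (weightedDegree a I) := by
  by_cases hI : I = []
  · subst hI; rw [freeBracket]; exact Submodule.zero_mem _
  induction I, hI using List.nonempty_rec with
  | single i =>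
    rw [freeBracket_singleton, weightedDegree_singleton]; exact of_mem_freeHomogeneous a i
  | cons i I hI ih =>
    rw [freeBracket_cons i hI, weightedDegree_cons]
    exact lie_mem_freeHomogeneous (of_mem_freeHomogeneous a i) ih

/-- The elements `x` with `[x, S] ⊆ S` form a subalgebra containing the generators, so the span `S`
is an ideal; being also a subalgebra that contains the generators, it is everything. -/
theorem span_freeBracket (p : ℕ) :
    Submodule.span ℝ (Set.range fun I : {I : List (Fin p) // I ≠ []} => freeBracket I.1) = ⊤ := by
  set S := Submodule.span ℝ (Set.range fun I : {I : List (Fin p) // I ≠ []} => freeBracket I.1)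
    with hS
  have hof : ∀ j, of ℝ j ∈ S := fun j =>
    Submodule.subset_span ⟨⟨[j], by simp⟩, freeBracket_singleton j⟩
  let K : LieSubalgebra ℝ (FreeLieAlgebra ℝ (Fin p)) :=
    { carrier := {x | ∀ y ∈ S, ⁅x, y⁆ ∈ S}
      zero_mem' := fun y _ => by simp
      add_mem' := fun hx hx' y hy => by
        rw [add_lie]; exact Submodule.add_mem _ (hx y hy) (hx' y hy)
      smul_mem' := fun c x hx y hy => by
        rw [smul_lie]; exact Submodule.smul_mem _ c (hx y hy)
      lie_mem' := fun {u v} hu hv y hy => by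
        rw [lie_lie]
        exact Submodule.sub_mem _ (hu _ (hv y hy)) (hv _ (hu y hy)) }
  have hK : K = ⊤ := lieSubalgebra_eq_top K fun j y hy => by
    induction hy using Submodule.span_induction with
    | mem x hx =>
      obtain ⟨⟨I, hI⟩, rfl⟩ := hx
      exact Submodule.subset_span ⟨⟨j :: I, by simp⟩, freeBracket_cons j hI⟩
    | zero => simp
    | add x y _ _ hx hy => rw [lie_add]; exact Submodule.add_mem _ hx hy
    | smul c x _ hx => rw [lie_smul]; exact Submodule.smul_mem _ c hx
  let K' : LieSubalgebra ℝ (FreeLieAlgebra ℝ (Fin p)) :=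
    { S with
      lie_mem' := fun {u v} _ hv => by
        have : u ∈ K := hK ▸ LieSubalgebra.mem_top u
        exact this v hv }
  have hK' : K' = ⊤ := lieSubalgebra_eq_top K' hof
  refine eq_top_iff.2 fun x _ => ?_
  have : x ∈ K' := hK' ▸ LieSubalgebra.mem_top x
  exact this

/-- The free Lie algebra has a basis of right-normed brackets. -/
theorem exists_freeBracket_basis (p : ℕ) :
    ∃ (κ : Type) (s : κ → List (Fin p)) (B : Module.Basis κ ℝ (FreeLieAlgebra ℝ (Fin p))),
      (∀ k, s k ≠ []) ∧ ∀ k, B k = freeBracket (s k) := by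
  obtain ⟨κ, f, -, hspan, hli⟩ := exists_linearIndependent' ℝ
    fun I : {I : List (Fin p) // I ≠ []} => freeBracket I.1
  refine ⟨κ, fun k => (f k).1, Module.Basis.mk hli ?_, fun k => (f k).2, fun k => ?_⟩
  · rw [hspan, span_freeBracket]
  · rw [Module.Basis.mk_apply]; rfl

/-! ### Homogeneous coordinates and the complement of the tail. -/

section Basis

variable {p : ℕ} {a : Fin p → ℕ} {κ : Type} {s : κ → List (Fin p)}
  {B : Module.Basis κ ℝ (FreeLieAlgebra ℝ (Fin p))}

/-- The dilation `Φ_2` is diagonal in the basis `B` with eigenvalues `2 ^ weight`, and different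
weights give different eigenvalues. -/
theorem repr_eq_zero_of_mem_freeHomogeneous (hB : ∀ k, B k = freeBracket (s k)) {l : ℕ}
    {x : FreeLieAlgebra ℝ (Fin p)} (hx : x ∈ freeHomogeneous a l) {k : κ}
    (hk : weightedDegree a (s k) ≠ l) : B.repr x k = 0 := by
  have key : ∀ y, B.repr (freeDilation a 2 y) k = 2 ^ weightedDegree a (s k) * B.repr y k := by
    intro y
    have : (Finsupp.lapply k ∘ₗ B.repr.toLinearMap) ∘ₗ (freeDilation a 2).toLinearMap =
        (2 ^ weightedDegree a (s k) : ℝ) • (Finsupp.lapply k ∘ₗ B.repr.toLinearMap) := by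
      refine B.ext fun j => ?_
      have h := freeBracket_mem_freeHomogeneous a (s j) 2 two_pos
      rw [← hB j] at h
      by_cases hjk : j = k
      · subst hjk; simp [h]
      · simp [h, hjk]
    simpa using LinearMap.congr_fun this y
  have h := key x
  rw [hx 2 two_pos, map_smul, Finsupp.smul_apply, smul_eq_mul] at h
  have h2 : ((2 : ℝ) ^ l - 2 ^ weightedDegree a (s k)) * B.repr x k = 0 := by linarith
  refine (mul_eq_zero.1 h2).resolve_left fun h0 => hk ?_
  exact (pow_right_injective₀ (by norm_num : (0 : ℝ) < 2) (by norm_num) (sub_eq_zero.1 h0)).symm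

theorem mem_span_of_mem_freeHomogeneous (hB : ∀ k, B k = freeBracket (s k)) {l : ℕ}
    {x : FreeLieAlgebra ℝ (Fin p)} (hx : x ∈ freeHomogeneous a l) :
    x ∈ Submodule.span ℝ (B '' {k | weightedDegree a (s k) = l}) := by
  rw [B.mem_span_image]
  intro k hk
  by_contra h
  exact (Finsupp.mem_support_iff.1 hk) (repr_eq_zero_of_mem_freeHomogeneous hB hx h)

/-- The span of the brackets of weight at most `t`. -/
noncomputable def freeHead {p : ℕ} (a : Fin p → ℕ) (t : ℕ) :
    Submodule ℝ (FreeLieAlgebra ℝ (Fin p)) :=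
  Submodule.span ℝ (freeBracket '' {I | I ≠ [] ∧ weightedDegree a I ≤ t})

theorem freeHead_eq_span (hs : ∀ k, s k ≠ []) (hB : ∀ k, B k = freeBracket (s k)) (t : ℕ) :
    freeHead a t = Submodule.span ℝ (B '' {k | weightedDegree a (s k) ≤ t}) := by
  apply le_antisymm
  · refine Submodule.span_le.2 ?_
    rintro _ ⟨I, ⟨-, hI⟩, rfl⟩
    refine Submodule.span_mono (Set.image_mono ?_)
      (mem_span_of_mem_freeHomogeneous hB (freeBracket_mem_freeHomogeneous a I))
    intro k (hk : _ = _)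
    exact hk.trans_le hI
  · refine Submodule.span_mono ?_
    rintro _ ⟨k, hk, rfl⟩
    exact ⟨s k, ⟨hs k, hk⟩, (hB k).symm⟩

theorem isCompl_freeTail_freeHead (a : Fin p → ℕ) (m : ℕ) :
    IsCompl (freeTail a m) (freeHead a m) := by
  obtain ⟨κ, s, B, hs, hB⟩ := exists_freeBracket_basis p
  have htail : freeTail a m ≤ Submodule.span ℝ (B '' {k | m < weightedDegree a (s k)}) := by
    refine iSup₂_le fun l hl x hx => ?_
    refine Submodule.span_mono (Set.image_mono ?_) (mem_span_of_mem_freeHomogeneous hB hx)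
    rintro k rfl
    exact hl
  constructor
  · rw [freeHead_eq_span hs hB]
    refine Disjoint.mono_left htail ?_
    refine B.linearIndependent.disjoint_span_image ?_
    rw [Set.disjoint_left]
    intro k (h : m < _) (h' : _ ≤ m)
    omega
  · rw [codisjoint_iff, eq_top_iff, ← span_freeBracket p, Submodule.span_le]
    rintro _ ⟨⟨I, hI⟩, rfl⟩
    by_cases h : weightedDegree a I ≤ m
    · exact Submodule.mem_sup_right (Submodule.subset_span ⟨I, ⟨hI, h⟩, rfl⟩)
    · exact Submodule.mem_sup_left (Submodule.mem_iSup_of_mem _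
        (Submodule.mem_iSup_of_mem (not_le.1 h) (freeBracket_mem_freeHomogeneous a I)))

theorem finrank_relFreeNilpotent (a : Fin p → ℕ) (m : ℕ) :
    Module.finrank ℝ (RelFreeNilpotent a m) = Module.finrank ℝ (freeHead a m) :=
  (Submodule.quotientEquivOfIsCompl _ _ (isCompl_freeTail_freeHead a m)).finrank_eq

theorem finite_weightedDegree_le (ha : ∀ i, 0 < a i) (t : ℕ) :
    {I : List (Fin p) | I ≠ [] ∧ weightedDegree a I ≤ t}.Finite := by
  refine (List.finite_length_le (Fin p) t).subset ?_
  rintro I ⟨-, hI⟩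
  exact (length_le_weightedDegree ha I).trans hI

theorem finiteDimensional_freeHead (ha : ∀ i, 0 < a i) (t : ℕ) :
    FiniteDimensional ℝ (freeHead a t) :=
  FiniteDimensional.span_of_finite ℝ ((finite_weightedDegree_le ha t).image _)

theorem freeHead_zero (ha : ∀ i, 0 < a i) : freeHead a 0 = ⊥ := by
  rw [freeHead, Submodule.span_eq_bot]
  rintro _ ⟨I, ⟨hI, h⟩, rfl⟩
  have := weightedDegree_pos ha hI
  exact absurd (h : _ ≤ 0) (by omega)

/-! ### Enveloping algebra elements -/

/-- The canonical map of the free Lie algebra to the free associative algebra. -/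
noncomputable def freeToAssoc (p : ℕ) : FreeLieAlgebra ℝ (Fin p) →ₗ⁅ℝ⁆ FreeAlgebra ℝ (Fin p) :=
  FreeLieAlgebra.lift ℝ (FreeAlgebra.ι ℝ)

theorem freeToAssoc_of (i : Fin p) : freeToAssoc p (of ℝ i) = FreeAlgebra.ι ℝ i := by
  simp [freeToAssoc]

theorem freeToAssoc_lie (x y : FreeLieAlgebra ℝ (Fin p)) :
    freeToAssoc p ⁅x, y⁆ = freeToAssoc p x * freeToAssoc p y - freeToAssoc p y * freeToAssoc p x := by
  rw [LieHom.map_lie, LieRing.of_associative_ring_bracket]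

/-- The coefficient `Q_i` in the decomposition `∑ i, Q_i * Y_i` of a right-normed bracket in the
free associative algebra according to the last letter. -/
noncomputable def lastLetterCoeff {p : ℕ} (i : Fin p) : List (Fin p) → FreeAlgebra ℝ (Fin p)
  | [] => 0
  | [j] => if i = j then 1 else 0
  | j :: k :: I => FreeAlgebra.ι ℝ j * lastLetterCoeff i (k :: I) -
      if i = j then freeToAssoc p (freeBracket (k :: I)) else 0

theorem lastLetterCoeff_singleton (i j : Fin p) :
    lastLetterCoeff i [j] = if i = j then 1 else 0 := by rw [lastLetterCoeff]

/-- In `Y_j y - y Y_j` the first product keeps the last letters of `y`, while the second ends in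
`Y_j` and contributes `-y` to that coefficient alone. -/
theorem lastLetterCoeff_cons (i j : Fin p) {I : List (Fin p)} (hI : I ≠ []) :
    lastLetterCoeff i (j :: I) = FreeAlgebra.ι ℝ j * lastLetterCoeff i I -
      if i = j then freeToAssoc p (freeBracket I) else 0 := by
  cases I with
  | nil => exact absurd rfl hI
  | cons j J => rw [lastLetterCoeff]

/-- The adjoint action of the free associative algebra on the free Lie algebra. -/
noncomputable def freeAdjoint (p : ℕ) :
    FreeAlgebra ℝ (Fin p) →ₐ[ℝ] Module.End ℝ (FreeLieAlgebra ℝ (Fin p)) :=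
  FreeAlgebra.lift ℝ fun i => LieAlgebra.ad ℝ _ (of ℝ i)

theorem freeAdjoint_ι (i : Fin p) (y : FreeLieAlgebra ℝ (Fin p)) :
    freeAdjoint p (FreeAlgebra.ι ℝ i) y = ⁅of ℝ i, y⁆ := by
  simp [freeAdjoint]

theorem freeAdjoint_freeBracket {I : List (Fin p)} (hI : I ≠ []) :
    ∀ y, freeAdjoint p (freeToAssoc p (freeBracket I)) y = ⁅freeBracket I, y⁆ := by
  induction I, hI using List.nonempty_rec with
  | single i => intro y; rw [freeBracket_singleton, freeToAssoc_of, freeAdjoint_ι]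
  | cons i I hI ih =>
    intro y
    rw [freeBracket_cons i hI, freeToAssoc_lie, map_sub, map_mul, map_mul, freeToAssoc_of,
      LinearMap.sub_apply, Module.End.mul_apply, Module.End.mul_apply, ih, ih, freeAdjoint_ι,
      freeAdjoint_ι, lie_lie]

/-- A weighted form of the Dynkin–Specht–Wever identity. -/
theorem sum_freeAdjoint_lastLetterCoeff (a : Fin p → ℕ) {I : List (Fin p)} (hI : I ≠ []) :
    ∑ i, (a i : ℝ) • freeAdjoint p (lastLetterCoeff i I) (of ℝ i) =
      (weightedDegree a I : ℝ) • freeBracket I := by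
  induction I, hI using List.nonempty_rec with
  | single j =>
    rw [Finset.sum_eq_single j]
    · simp [lastLetterCoeff_singleton, weightedDegree_singleton, freeBracket_singleton]
    · intro i _ hij; simp [lastLetterCoeff_singleton, hij]
    · simp
  | cons j I hI ih =>
    have h1 : ∀ i, (a i : ℝ) • freeAdjoint p (lastLetterCoeff i (j :: I)) (of ℝ i) =
        ⁅of ℝ j, (a i : ℝ) • freeAdjoint p (lastLetterCoeff i I) (of ℝ i)⁆ -
          if i = j then (a j : ℝ) • ⁅freeBracket I, of ℝ j⁆ else 0 := by
      intro i
      rw [lastLetterCoeff_cons i j hI, map_sub, map_mul, LinearMap.sub_apply, Module.End.mul_apply,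
        freeAdjoint_ι, smul_sub, lie_smul]
      split_ifs with h
      · subst h; rw [freeAdjoint_freeBracket hI]
      · simp
    -- The correction `-a_j [Y_I, Y_j] = a_j [Y_j, Y_I]` raises the factor from `|I|` to `a_j +
    -- |I|`.
    rw [Finset.sum_congr rfl fun i _ => h1 i, Finset.sum_sub_distrib, ← lie_sum, ih,
      Finset.sum_ite_eq' Finset.univ j, if_pos (Finset.mem_univ j), lie_smul, freeBracket_cons j hI,
      weightedDegree_cons, ← lie_skew, Nat.cast_add, add_smul, smul_neg, sub_eq_add_neg, add_comm, ← smul_neg, lie_skew]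

end Basis

/-! ### A filtration of the free associative algebra by products of basis brackets -/

section Filtration

variable {p : ℕ} {a : Fin p → ℕ} {κ : Type} {s : κ → List (Fin p)}
  {B : Module.Basis κ ℝ (FreeLieAlgebra ℝ (Fin p))}

/-- The product in the free associative algebra of the brackets indexed by `l`. -/
noncomputable def bracketProd (s : κ → List (Fin p)) (l : List κ) : FreeAlgebra ℝ (Fin p) :=
  (l.map fun k => freeToAssoc p (freeBracket (s k))).prod

/-- The total weight of a list of brackets. -/
def totalWeight (a : Fin p → ℕ) (s : κ → List (Fin p)) (l : List κ) : ℕ :=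
  (l.map fun k => weightedDegree a (s k)).sum

/-- The span of the products of at most `k` brackets of total weight at most `w`. -/
noncomputable def bracketFiltration (a : Fin p → ℕ) (s : κ → List (Fin p)) (k w : ℕ) :
    Submodule ℝ (FreeAlgebra ℝ (Fin p)) :=
  Submodule.span ℝ (bracketProd s '' {l | l.length ≤ k ∧ totalWeight a s l ≤ w})

@[simp] theorem bracketProd_nil : bracketProd s [] = 1 := rfl

@[simp] theorem bracketProd_cons (k : κ) (l : List κ) :
    bracketProd s (k :: l) = freeToAssoc p (freeBracket (s k)) * bracketProd s l := rfl

@[simp] theorem totalWeight_nil : totalWeight a s [] = 0 := rfl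

@[simp] theorem totalWeight_cons (k : κ) (l : List κ) :
    totalWeight a s (k :: l) = weightedDegree a (s k) + totalWeight a s l := rfl

theorem totalWeight_perm {l l' : List κ} (h : l.Perm l') : totalWeight a s l = totalWeight a s l' :=
  (h.map _).sum_eq

theorem bracketFiltration_mono {k k' w w' : ℕ} (hk : k ≤ k') (hw : w ≤ w') :
    bracketFiltration a s k w ≤ bracketFiltration a s k' w' := by
  refine Submodule.span_mono (Set.image_mono ?_)
  rintro l ⟨h1, h2⟩
  exact ⟨h1.trans hk, h2.trans hw⟩

theorem bracketProd_mem {l : List κ} {k w : ℕ} (hk : l.length ≤ k) (hw : totalWeight a s l ≤ w) :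
    bracketProd s l ∈ bracketFiltration a s k w :=
  Submodule.subset_span ⟨l, ⟨hk, hw⟩, rfl⟩

theorem one_mem_bracketFiltration (k w : ℕ) : 1 ∈ bracketFiltration a s k w :=
  bracketProd_mem (l := []) (by simp) (by simp)

theorem freeToAssoc_basis_mul_mem {j : κ} {k w : ℕ} {P : FreeAlgebra ℝ (Fin p)}
    (hP : P ∈ bracketFiltration a s k w) :
    freeToAssoc p (freeBracket (s j)) * P ∈
      bracketFiltration a s (k + 1) (weightedDegree a (s j) + w) := by
  induction hP using Submodule.span_induction with
  | mem x hx =>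
    obtain ⟨l, ⟨hl, hl'⟩, rfl⟩ := hx
    rw [← bracketProd_cons]
    exact bracketProd_mem (by simpa using hl) (by simpa using hl')
  | zero => simp
  | add x y _ _ hx hy => rw [mul_add]; exact Submodule.add_mem _ hx hy
  | smul c x _ hx => rw [mul_smul_comm]; exact Submodule.smul_mem _ c hx

theorem freeToAssoc_mul_mem (hB : ∀ k, B k = freeBracket (s k)) {l k w : ℕ}
    {x : FreeLieAlgebra ℝ (Fin p)} (hx : x ∈ freeHomogeneous a l) {P : FreeAlgebra ℝ (Fin p)}
    (hP : P ∈ bracketFiltration a s k w) :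
    freeToAssoc p x * P ∈ bracketFiltration a s (k + 1) (l + w) := by
  have hx' := mem_span_of_mem_freeHomogeneous hB hx
  clear hx
  induction hx' using Submodule.span_induction with
  | mem x hx =>
    obtain ⟨j, (hj : _ = _), rfl⟩ := hx
    rw [hB, ← hj]
    exact freeToAssoc_basis_mul_mem hP
  | zero => simp
  | add x y _ _ hx hy => rw [map_add, add_mul]; exact Submodule.add_mem _ hx hy
  | smul c x _ hx => rw [map_smul, smul_mul_assoc]; exact Submodule.smul_mem _ c hx

theorem freeToAssoc_mem (hB : ∀ k, B k = freeBracket (s k)) {l : ℕ}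
    {x : FreeLieAlgebra ℝ (Fin p)} (hx : x ∈ freeHomogeneous a l) :
    freeToAssoc p x ∈ bracketFiltration a s 1 l := by
  simpa using freeToAssoc_mul_mem hB hx (one_mem_bracketFiltration 0 0)

/-- Exchanging two neighboring factors costs their commutator, a homogeneous Lie element of the same
total weight that takes the place of two factors. -/
theorem bracketProd_sub_mem_of_perm (hB : ∀ k, B k = freeBracket (s k)) {l l' : List κ}
    (h : l.Perm l') :
    bracketProd s l - bracketProd s l' ∈
      bracketFiltration a s (l.length - 1) (totalWeight a s l) := by
  induction h with
  | nil => simp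
  | @cons j l l' h ih =>
    rw [bracketProd_cons, bracketProd_cons, ← mul_sub]
    -- Truncated subtraction makes `l.length - 1 + 1` too large for `l = []`, but then the
    -- difference is zero.
    by_cases hl : l = []
    · subst hl
      simp [h.nil_eq.symm]
    · refine bracketFiltration_mono ?_ le_rfl (freeToAssoc_basis_mul_mem ih)
      have := List.length_pos_iff.2 hl
      simp only [List.length_cons]
      omega
  | swap i j l =>
    have h1 : bracketProd s (j :: i :: l) - bracketProd s (i :: j :: l) =
        freeToAssoc p ⁅freeBracket (s j), freeBracket (s i)⁆ * bracketProd s l := by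
      simp only [bracketProd_cons, freeToAssoc_lie]
      noncomm_ring
    rw [h1]
    have h2 := freeToAssoc_mul_mem hB
      (lie_mem_freeHomogeneous (freeBracket_mem_freeHomogeneous a (s j))
        (freeBracket_mem_freeHomogeneous a (s i)))
      (bracketProd_mem (a := a) (s := s) (l := l) le_rfl le_rfl)
    refine bracketFiltration_mono ?_ ?_ h2
    · simp
    · simp only [totalWeight_cons]; omega
  | @trans l₁ l₂ l₃ h₁ h₂ ih₁ ih₂ =>
    rw [← h₁.length_eq, ← totalWeight_perm h₁] at ih₂
    simpa using Submodule.add_mem _ ih₁ ih₂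

theorem prod_map_X_eq_monomial [DecidableEq κ] (l : List κ) :
    (l.map (MvPolynomial.X (R := ℝ))).prod =
      MvPolynomial.monomial (Multiset.toFinsupp (l : Multiset κ)) 1 := by
  induction l with
  | nil => simp
  | cons i l ih =>
    rw [List.map_cons, List.prod_cons, ih, ← Multiset.cons_coe, ← Multiset.singleton_add, map_add,
      Multiset.toFinsupp_singleton, MvPolynomial.X, MvPolynomial.monomial_mul, one_mul]

/-- If the commutative symbol of a combination of products of `k + 1` brackets vanishes, then the
combination is a combination of products of at most `k` brackets. -/
theorem linearCombination_mem_of_symbol_eq_zero (hB : ∀ k, B k = freeBracket (s k)) {k w : ℕ}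
    {c : List κ →₀ ℝ}
    (hc : c ∈ Finsupp.supported ℝ ℝ {l : List κ | l.length = k + 1 ∧ totalWeight a s l ≤ w})
    (h0 : ∀ v : κ → ℝ, (c.sum fun l r => r * (l.map v).prod) = 0) :
    Finsupp.linearCombination ℝ (bracketProd s) c ∈ bracketFiltration a s k w := by
  classical
  -- A polynomial over the infinite field `ℝ` that vanishes at every point is zero.
  have hq : (c.sum fun l r => r • (l.map (MvPolynomial.X (R := ℝ))).prod) = 0 := by
    refine MvPolynomial.funext fun v => ?_
    rw [map_zero, ← h0 v, map_finsuppSum]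
    refine Finsupp.sum_congr fun l _ => ?_
    rw [MvPolynomial.smul_eval, map_list_prod, List.map_map]
    congr 3
    ext i
    simp
  -- `Φ` turns a commutative monomial into a product of brackets in an arbitrary order. For degree
  -- `k + 1` and weight at most `w` the order does not matter modulo shorter products.
  let Φ : MvPolynomial κ ℝ →ₗ[ℝ] FreeAlgebra ℝ (Fin p) ⧸ bracketFiltration a s k w :=
    (MvPolynomial.basisMonomials κ ℝ).constr ℝ fun e =>
      (bracketFiltration a s k w).mkQ (bracketProd s (Finsupp.toMultiset e).toList)
  have hΦ : ∀ l : List κ, l.length = k + 1 → totalWeight a s l ≤ w →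
      Φ (l.map (MvPolynomial.X (R := ℝ))).prod =
        (bracketFiltration a s k w).mkQ (bracketProd s l) := by
    intro l hl hw
    have h1 : Φ (MvPolynomial.monomial (Multiset.toFinsupp (l : Multiset κ)) 1) =
        (bracketFiltration a s k w).mkQ (bracketProd s (l : Multiset κ).toList) := by
      have h := (MvPolynomial.basisMonomials κ ℝ).constr_basis ℝ
        (fun e => (bracketFiltration a s k w).mkQ (bracketProd s (Finsupp.toMultiset e).toList))
        (Multiset.toFinsupp (l : Multiset κ))
      rwa [MvPolynomial.coe_basisMonomials, Multiset.toFinsupp_toMultiset] at h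
    rw [prod_map_X_eq_monomial, h1, ← sub_eq_zero, ← map_sub, Submodule.mkQ_apply,
      Submodule.Quotient.mk_eq_zero]
    have hp : ((l : Multiset κ).toList).Perm l := by
      rw [← Multiset.coe_eq_coe, Multiset.coe_toList]
    have h2 := bracketProd_sub_mem_of_perm (a := a) hB hp
    rw [totalWeight_perm hp, hp.length_eq, hl] at h2
    exact bracketFiltration_mono le_rfl hw h2
  rw [← Submodule.Quotient.mk_eq_zero, ← Submodule.mkQ_apply, Finsupp.linearCombination_apply,
    map_finsuppSum, ← map_zero Φ, ← hq, map_finsuppSum]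
  refine Finsupp.sum_congr fun l hl => ?_
  obtain ⟨h1, h2⟩ := hc hl
  rw [map_smul, map_smul, hΦ l h1 h2]

/-- Stripping the last letter lowers the weight by at least one. This gain puts the coefficients in
the range of weights where evaluation is injective. -/
theorem lastLetterCoeff_mem (ha : ∀ i, 0 < a i) (hB : ∀ k, B k = freeBracket (s k)) (i : Fin p)
    {I : List (Fin p)} (hI : I ≠ []) :
    lastLetterCoeff i I ∈ bracketFiltration a s I.length (weightedDegree a I - 1) := by
  induction I, hI using List.nonempty_rec with
  | single j =>
    rw [lastLetterCoeff_singleton]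
    split_ifs
    · exact one_mem_bracketFiltration _ _
    · exact Submodule.zero_mem _
  | cons j I hI ih =>
    have hj := ha j
    have hpos := weightedDegree_pos ha hI
    rw [lastLetterCoeff_cons i j hI, weightedDegree_cons, List.length_cons]
    refine Submodule.sub_mem _ ?_ ?_
    · rw [← freeToAssoc_of]
      exact bracketFiltration_mono le_rfl (by omega)
        (freeToAssoc_mul_mem hB (of_mem_freeHomogeneous a j) ih)
    · split_ifs
      · exact bracketFiltration_mono (by omega) (by omega)
          (freeToAssoc_mem hB (freeBracket_mem_freeHomogeneous a I))
      · exact Submodule.zero_mem _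

theorem sum_lastLetterCoeff_mem (ha : ∀ i, 0 < a i) (hs : ∀ k, s k ≠ [])
    (hB : ∀ k, B k = freeBracket (s k)) (i : Fin p) {t : ℕ} {x : FreeLieAlgebra ℝ (Fin p)}
    (hx : x ∈ freeHead a t) :
    ((B.repr x).sum fun k r => r • lastLetterCoeff i (s k)) ∈ bracketFiltration a s t (t - 1) := by
  rw [freeHead_eq_span hs hB, B.mem_span_image] at hx
  refine Submodule.sum_mem _ fun k hk => Submodule.smul_mem _ _ ?_
  have hk' : weightedDegree a (s k) ≤ t := hx hk
  exact bracketFiltration_mono ((length_le_weightedDegree ha _).trans hk') (by omega)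
    (lastLetterCoeff_mem ha hB i (hs k))

/-- By `sum_freeAdjoint_lastLetterCoeff` the coefficients determine `x` with each coordinate
multiplied by its weight, and the weights are nonzero. -/
theorem exists_sum_lastLetterCoeff_ne_zero (ha : ∀ i, 0 < a i) (hs : ∀ k, s k ≠ [])
    (hB : ∀ k, B k = freeBracket (s k)) {x : FreeLieAlgebra ℝ (Fin p)} (hx : x ≠ 0) :
    ∃ i, ((B.repr x).sum fun k r => r • lastLetterCoeff i (s k)) ≠ 0 := by
  by_contra! h
  refine hx (B.repr.map_eq_zero_iff.1 (Finsupp.ext fun k => ?_))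
  have h1 : ∑ k ∈ (B.repr x).support, (B.repr x k * weightedDegree a (s k)) • B k = 0 := by
    have h2 : ∀ k, (B.repr x k * weightedDegree a (s k)) • B k =
        ∑ i, (a i : ℝ) • freeAdjoint p (B.repr x k • lastLetterCoeff i (s k)) (of ℝ i) := by
      intro k
      rw [hB, mul_smul, ← sum_freeAdjoint_lastLetterCoeff a (hs k), Finset.smul_sum]
      refine Finset.sum_congr rfl fun i _ => ?_
      rw [map_smul, LinearMap.smul_apply, smul_comm]
    rw [Finset.sum_congr rfl fun k _ => h2 k, Finset.sum_comm]
    refine Finset.sum_eq_zero fun i _ => ?_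
    rw [← Finset.smul_sum, ← LinearMap.sum_apply, ← map_sum]
    have h3 := h i
    rw [Finsupp.sum] at h3
    rw [h3, map_zero, LinearMap.zero_apply, smul_zero]
  by_cases hk : k ∈ (B.repr x).support
  · have h4 := linearIndependent_iff'.1 B.linearIndependent _ _ h1 k hk
    have := weightedDegree_pos ha (hs k)
    exact (mul_eq_zero.1 h4).resolve_right (Nat.cast_ne_zero.2 (by omega))
  · exact Finsupp.notMem_support_iff.1 hk

end Filtration

/-! ### Differential operators at a point -/

section Operators

variable {R : Type*} [CommRing R] [Algebra ℝ R]

/-- Each derivation lowers the order of vanishing by at most one. The prefactor `g` makes the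
induction work, since peeling off the innermost derivation changes it. -/
theorem eval_derivations_mul_pow_of_lt (ev : R →ₐ[ℝ] ℝ) {f : R} (hf : ev f = 0) {κ : Type*}
    (D : κ → Derivation ℝ R R) (l : List κ) :
    ∀ (n : ℕ) (g : R), l.length < n →
      ev ((l.map fun k => ((D k : R →ₗ[ℝ] R) : Module.End ℝ R)).prod (g * f ^ n)) = 0 := by
  induction l using List.reverseRecOn with
  | nil =>
    intro n g hn
    have : n ≠ 0 := by simp at hn; omega
    simp [hf, this]
  | append_singleton l k ih =>
    intro n g hn
    obtain ⟨n, rfl⟩ : ∃ n', n = n' + 1 := ⟨n - 1, by simp at hn; omega⟩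
    have h1 : D k (g * f ^ (n + 1)) = D k g * f ^ (n + 1) + ((n + 1 : ℕ) * g * D k f) * f ^ n := by
      rw [Derivation.leibniz, Derivation.leibniz_pow]
      simp only [smul_eq_mul, nsmul_eq_mul, Nat.add_sub_cancel]
      ring
    rw [List.length_append, List.length_singleton] at hn
    rw [List.map_append, List.prod_append, List.map_singleton, List.prod_singleton,
      Module.End.mul_apply, Derivation.coeFn_coe, h1, map_add, map_add, ih _ _ (by omega),
      ih _ _ (by omega), add_zero]

/-- Only the terms in which the derivations hit distinct factors `f` survive; the factorial counts
them. Thus powers of `f` read off the commutative symbol. -/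
theorem eval_derivations_mul_pow (ev : R →ₐ[ℝ] ℝ) {f : R} (hf : ev f = 0) {κ : Type*}
    (D : κ → Derivation ℝ R R) (l : List κ) :
    ∀ g : R, ev ((l.map fun k => ((D k : R →ₗ[ℝ] R) : Module.End ℝ R)).prod (g * f ^ l.length)) =
      l.length.factorial * ev g * (l.map fun k => ev (D k f)).prod := by
  induction l using List.reverseRecOn with
  | nil => intro g; simp
  | append_singleton l k ih =>
    intro g
    have h1 : D k (g * f ^ (l.length + 1)) =
        D k g * f ^ (l.length + 1) + ((l.length + 1 : ℕ) * g * D k f) * f ^ l.length := by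
      rw [Derivation.leibniz, Derivation.leibniz_pow]
      simp only [smul_eq_mul, nsmul_eq_mul, Nat.add_sub_cancel]
      ring
    rw [List.length_append, List.length_singleton, List.map_append, List.prod_append,
      List.map_singleton, List.prod_singleton,
      Module.End.mul_apply, Derivation.coeFn_coe, h1, map_add, map_add,
      eval_derivations_mul_pow_of_lt ev hf D l _ _ (by omega), ih, zero_add, List.map_append,
      List.prod_append, List.map_singleton, List.prod_singleton, Nat.factorial_succ]
    push_cast
    simp only [map_mul, map_add, map_natCast, map_one]
    ring

/-- The action of the free Lie algebra by derivations. -/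
noncomputable def freeDerivation {p : ℕ} (D : Fin p → Derivation ℝ R R) :
    FreeLieAlgebra ℝ (Fin p) →ₗ⁅ℝ⁆ Derivation ℝ R R :=
  FreeLieAlgebra.lift ℝ D

/-- The action of the free associative algebra by differential operators. -/
noncomputable def freeOperator {p : ℕ} (D : Fin p → Derivation ℝ R R) :
    FreeAlgebra ℝ (Fin p) →ₐ[ℝ] Module.End ℝ R :=
  FreeAlgebra.lift ℝ fun i => ((D i : R →ₗ[ℝ] R) : Module.End ℝ R)

theorem freeOperator_ι {p : ℕ} (D : Fin p → Derivation ℝ R R) (i : Fin p) (f : R) :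
    freeOperator D (FreeAlgebra.ι ℝ i) f = D i f := by
  simp [freeOperator]

theorem freeOperator_freeBracket {p : ℕ} (D : Fin p → Derivation ℝ R R) {I : List (Fin p)}
    (hI : I ≠ []) : freeOperator D (freeToAssoc p (freeBracket I)) =
      ((freeDerivation D (freeBracket I) : R →ₗ[ℝ] R) : Module.End ℝ R) := by
  induction I, hI using List.nonempty_rec with
  | single i =>
    rw [freeBracket_singleton, freeToAssoc_of]
    ext f
    simp [freeOperator, freeDerivation]
  | cons i I hI ih =>
    rw [freeBracket_cons i hI, freeToAssoc_lie, map_sub, map_mul, map_mul, freeToAssoc_of, ih]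
    ext f
    rw [LieHom.map_lie]
    simp only [LinearMap.sub_apply, Module.End.mul_apply, freeOperator_ι, Derivation.coeFn_coe,
      Derivation.commutator_apply]
    simp [freeDerivation]

variable {p : ℕ} {a : Fin p → ℕ} {κ : Type} {s : κ → List (Fin p)}
  {B : Module.Basis κ ℝ (FreeLieAlgebra ℝ (Fin p))}

theorem freeOperator_bracketProd (D : Fin p → Derivation ℝ R R) (hs : ∀ k, s k ≠ []) (l : List κ) :
    freeOperator D (bracketProd s l) =
      (l.map fun k => ((freeDerivation D (freeBracket (s k)) : R →ₗ[ℝ] R) : Module.End ℝ R)).prod := by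
  rw [bracketProd, map_list_prod, List.map_map]
  congr 2
  ext1 k
  exact freeOperator_freeBracket D (hs k)

/-- If the values at a point of the brackets of weight at most `t` can be prescribed
independently, then so can those of differential operators of weight at most `t`. -/
theorem eq_zero_of_eval_freeOperator_eq_zero (hs : ∀ k, s k ≠ [])
    (hB : ∀ k, B k = freeBracket (s k)) (ev : R →ₐ[ℝ] ℝ) (D : Fin p → Derivation ℝ R R) {t : ℕ}
    (hD : ∀ v : κ → ℝ, ∃ f, ev f = 0 ∧ ∀ k, weightedDegree a (s k) ≤ t →
      ev (freeDerivation D (freeBracket (s k)) f) = v k) (k : ℕ) :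
    ∀ P ∈ bracketFiltration a s k t, (∀ f, ev (freeOperator D P f) = 0) → P = 0 := by
  induction k with
  | zero =>
    intro P hP h
    have hP' : P ∈ Submodule.span ℝ {(1 : FreeAlgebra ℝ (Fin p))} := by
      refine Submodule.span_mono ?_ hP
      rintro _ ⟨l, ⟨hl, -⟩, rfl⟩
      rw [List.length_eq_zero_iff.1 (Nat.le_zero.1 hl)]
      exact rfl
    obtain ⟨r, rfl⟩ := Submodule.mem_span_singleton.1 hP'
    have h1 := h 1
    rw [map_smul, map_one (freeOperator D), LinearMap.smul_apply, Module.End.one_apply, map_smul,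
      map_one, smul_eq_mul, mul_one] at h1
    rw [h1, zero_smul]
  | succ k ih =>
    intro P hP h
    -- It remains to lower the length bound of `P` by one; only its part of length exactly `k + 1`
    -- needs work.
    refine ih P ?_ h
    have hsplit : bracketFiltration a s (k + 1) t ≤
        Submodule.span ℝ (bracketProd s '' {l | l.length = k + 1 ∧ totalWeight a s l ≤ t}) ⊔
          bracketFiltration a s k t := by
      refine Submodule.span_le.2 ?_
      rintro _ ⟨l, ⟨hl, hw⟩, rfl⟩
      rcases Nat.lt_or_ge k l.length with hk | hk
      · exact Submodule.mem_sup_left (Submodule.subset_span ⟨l, ⟨by omega, hw⟩, rfl⟩)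
      · exact Submodule.mem_sup_right (bracketProd_mem hk hw)
    obtain ⟨P₁, hP₁, P₂, hP₂, rfl⟩ := Submodule.mem_sup.1 (hsplit hP)
    refine Submodule.add_mem _ ?_ hP₂
    obtain ⟨c, hc, rfl⟩ := (Finsupp.mem_span_image_iff_linearCombination ℝ).1 hP₁
    refine linearCombination_mem_of_symbol_eq_zero hB hc fun v => ?_
    obtain ⟨f, hf, hfv⟩ := hD v
    -- On `f ^ (k + 1)` the products of at most `k` brackets do not contribute.
    have h2 : ev (freeOperator D P₂ (f ^ (k + 1))) = 0 := by
      clear hP h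
      induction hP₂ using Submodule.span_induction with
      | mem x hx =>
        obtain ⟨l, ⟨hl, -⟩, rfl⟩ := hx
        rw [freeOperator_bracketProd D hs]
        have := eval_derivations_mul_pow_of_lt ev hf
          (fun k => freeDerivation D (freeBracket (s k))) l (k + 1) 1 (by omega)
        rwa [one_mul] at this
      | zero => simp
      | add x y _ _ hx hy => rw [map_add, LinearMap.add_apply, map_add, hx, hy, add_zero]
      | smul c x _ hx => rw [map_smul, LinearMap.smul_apply, map_smul, hx, smul_zero]
    have h1 := h (f ^ (k + 1))
    rw [map_add, LinearMap.add_apply, map_add, h2, add_zero, Finsupp.linearCombination_apply,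
      map_finsuppSum, LinearMap.finsupp_sum_apply, map_finsuppSum] at h1
    have h3 : (((k + 1).factorial : ℕ) : ℝ) * (c.sum fun l r => r * (l.map v).prod) = 0 := by
      rw [← h1, Finsupp.mul_sum]
      refine Finsupp.sum_congr fun l hl => ?_
      obtain ⟨hlen, hw⟩ := hc hl
      have h4 := eval_derivations_mul_pow ev hf
        (fun k => freeDerivation D (freeBracket (s k))) l 1
      rw [one_mul, hlen, map_one, mul_one] at h4
      rw [map_smul, LinearMap.smul_apply, map_smul, freeOperator_bracketProd D hs, h4, smul_eq_mul,
        mul_left_comm]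
      congr 2
      refine congrArg List.prod ?_
      refine List.map_congr_left fun j hj => (hfv j ?_).symm
      -- A single factor weighs no more than the whole product, so its value on `f` is a prescribed
      -- one.
      exact (List.single_le_sum (by simp) _ (List.mem_map_of_mem hj)).trans hw
    exact (mul_eq_zero.1 h3).resolve_left (Nat.cast_ne_zero.2 (Nat.factorial_ne_zero _))

end Operators

/-! ### Smooth vector fields as derivations -/

section SmoothFunctions

variable {E : Type*} [NormedAddCommGroup E] [NormedSpace ℝ E] {p : ℕ}

theorem iteratedCommutator_singleton (X : Fin p → E → E) (i : Fin p) :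
    iteratedCommutator X [i] = X i := by rw [iteratedCommutator]

theorem iteratedCommutator_cons (X : Fin p → E → E) (i : Fin p) {I : List (Fin p)} (hI : I ≠ []) :
    iteratedCommutator X (i :: I) = VectorField.lieBracket ℝ (X i) (iteratedCommutator X I) := by
  cases I with
  | nil => exact absurd rfl hI
  | cons j J => rw [iteratedCommutator]

theorem ContDiffOn.iteratedCommutator {X : Fin p → E → E} {O : Set E} (hO : IsOpen O)
    (hX : ∀ i, ContDiffOn ℝ ∞ (X i) O) (I : List (Fin p)) :
    ContDiffOn ℝ ∞ (iteratedCommutator X I) O := by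
  by_cases hI : I = []
  · subst hI; rw [_root_.iteratedCommutator]; exact contDiffOn_const
  induction I, hI using List.nonempty_rec with
  | single i => rw [iteratedCommutator_singleton]; exact hX i
  | cons i I hI ih =>
    rw [iteratedCommutator_cons X i hI]
    intro x hx
    have h := ((hX i).contDiffAt (hO.mem_nhds hx)).lieBracket_vectorField
      (ih.contDiffAt (hO.mem_nhds hx)) (m := ∞) (by simp)
    exact h.contDiffWithinAt

theorem ContDiff.iteratedCommutator {X : Fin p → E → E} (hX : ∀ i, ContDiff ℝ ∞ (X i))
    (I : List (Fin p)) : ContDiff ℝ ∞ (iteratedCommutator X I) :=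
  contDiffOn_univ.1 (ContDiffOn.iteratedCommutator isOpen_univ (fun i => (hX i).contDiffOn) I)

theorem Filter.EventuallyEq.iteratedCommutator {X Y : Fin p → E → E} {x : E}
    (h : ∀ i, X i =ᶠ[nhds x] Y i) (I : List (Fin p)) :
    iteratedCommutator X I =ᶠ[nhds x] _root_.iteratedCommutator Y I := by
  by_cases hI : I = []
  · subst hI; rw [_root_.iteratedCommutator, _root_.iteratedCommutator]
  induction I, hI using List.nonempty_rec with
  | single i => rw [iteratedCommutator_singleton, iteratedCommutator_singleton]; exact h i
  | cons i I hI ih =>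
    rw [iteratedCommutator_cons X i hI, iteratedCommutator_cons Y i hI]
    exact (h i).lieBracket_vectorField ih

variable (E) in
/-- The algebra of smooth real functions. -/
def smoothFunctions : Subalgebra ℝ (E → ℝ) where
  carrier := {f | ContDiff ℝ ∞ f}
  mul_mem' := fun {f g} (hf : ContDiff ℝ ∞ f) (hg : ContDiff ℝ ∞ g) =>
    (hf.mul hg : ContDiff ℝ ∞ (f * g))
  add_mem' := fun {f g} (hf : ContDiff ℝ ∞ f) (hg : ContDiff ℝ ∞ g) =>
    (hf.add hg : ContDiff ℝ ∞ (f + g))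
  algebraMap_mem' := fun r => (contDiff_const : ContDiff ℝ ∞ fun _ : E => r)

theorem smoothFunctions.mem {f : E → ℝ} (hf : ContDiff ℝ ∞ f) : f ∈ smoothFunctions E := hf

theorem smoothFunctions.contDiff (f : smoothFunctions E) : ContDiff ℝ ∞ (f : E → ℝ) := f.2

theorem smoothFunctions.differentiable (f : smoothFunctions E) : Differentiable ℝ (f : E → ℝ) :=
  (smoothFunctions.contDiff f).differentiable (by simp)

/-- The value of a smooth function at a point. -/
def smoothFunctions.eval (x : E) : smoothFunctions E →ₐ[ℝ] ℝ :=
  (Pi.evalAlgHom ℝ (fun _ : E => ℝ) x).comp (smoothFunctions E).val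

@[simp] theorem smoothFunctions.eval_apply (x : E) (f : smoothFunctions E) :
    smoothFunctions.eval x f = (f : E → ℝ) x := rfl

/-- A continuous linear functional as a smooth function. -/
def smoothFunctions.ofDual (φ : E →L[ℝ] ℝ) : smoothFunctions E :=
  ⟨φ, (φ.contDiff : ContDiff ℝ ∞ φ)⟩

@[simp] theorem smoothFunctions.coe_ofDual (φ : E →L[ℝ] ℝ) :
    (smoothFunctions.ofDual φ : E → ℝ) = φ := rfl

/-- The derivation of the algebra of smooth functions given by a smooth vector field. -/
noncomputable def vectorFieldDerivation (V : E → E) (hV : ContDiff ℝ ∞ V) :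
    Derivation ℝ (smoothFunctions E) (smoothFunctions E) :=
  Derivation.mk'
    { toFun := fun f => ⟨fun x => fderiv ℝ (f : E → ℝ) x (V x), smoothFunctions.mem
        (((smoothFunctions.contDiff f).fderiv_right (m := ∞) (by simp)).clm_apply hV)⟩
      map_add' := fun f g => by
        ext x
        have := fderiv_add (smoothFunctions.differentiable f x) (smoothFunctions.differentiable g x)
        simp [this]
      map_smul' := fun c f => by
        ext x
        have := fderiv_const_smul (smoothFunctions.differentiable f x) c
        simp [this] }
    fun f g => by
      ext x
      have := fderiv_mul (smoothFunctions.differentiable f x) (smoothFunctions.differentiable g x)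
      simp [this]

@[simp] theorem vectorFieldDerivation_apply (V : E → E) (hV : ContDiff ℝ ∞ V)
    (f : smoothFunctions E) (x : E) :
    (vectorFieldDerivation V hV f : E → ℝ) x = fderiv ℝ f x (V x) := rfl

/-- The derivations given by the members of a family of smooth vector fields. -/
noncomputable def fieldDerivations (X : Fin p → E → E) (hX : ∀ i, ContDiff ℝ ∞ (X i)) (i : Fin p) :
    Derivation ℝ (smoothFunctions E) (smoothFunctions E) :=
  vectorFieldDerivation (X i) (hX i)

theorem freeDerivation_freeBracket_apply (X : Fin p → E → E) (hX : ∀ i, ContDiff ℝ ∞ (X i))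
    {I : List (Fin p)} (hI : I ≠ []) :
    freeDerivation (fieldDerivations X hX) (freeBracket I) =
      vectorFieldDerivation (iteratedCommutator X I) (ContDiff.iteratedCommutator hX I) := by
  induction I, hI using List.nonempty_rec with
  | single i =>
    ext f x
    simp [freeBracket_singleton, freeDerivation, fieldDerivations, iteratedCommutator_singleton]
  | cons i I hI ih =>
    rw [freeBracket_cons i hI, LieHom.map_lie, ih]
    ext f x
    have h1 : freeDerivation (fieldDerivations X hX) (of ℝ i) =
        vectorFieldDerivation (X i) (hX i) := by simp [freeDerivation, fieldDerivations]
    have hc := ContDiff.iteratedCommutator hX I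
    rw [h1, Derivation.commutator_apply, vectorFieldDerivation_apply, iteratedCommutator_cons X i hI,
      VectorField.fderiv_apply_lieBracket (smoothFunctions.contDiff f).contDiffAt
        (n := ∞) (by simpa using (WithTop.coe_le_coe.2 le_top : ((2 : ℕ∞) : WithTop ℕ∞) ≤ ∞))
        (hc.differentiable (by simp) x) ((hX i).differentiable (by simp) x)]
    rfl

/-- Evaluation at a point of the vector fields represented by elements of the free Lie algebra. -/
theorem exists_freeEvaluation [FiniteDimensional ℝ E] (X : Fin p → E → E)
    (hX : ∀ i, ContDiff ℝ ∞ (X i)) (x : E) :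
    ∃ L : FreeLieAlgebra ℝ (Fin p) →ₗ[ℝ] E,
      (∀ y (φ : E →L[ℝ] ℝ), φ (L y) = smoothFunctions.eval x
        (freeDerivation (fieldDerivations X hX) y (smoothFunctions.ofDual φ))) ∧
      ∀ I, I ≠ [] → L (freeBracket I) = iteratedCommutator X I x := by
  -- A derivation at `x`, applied to linear functions, is an element of the bidual, hence a vector
  -- of `E`.
  let T : FreeLieAlgebra ℝ (Fin p) →ₗ[ℝ] Module.Dual ℝ (Module.Dual ℝ E) :=
    LinearMap.mk₂ ℝ (fun y φ => smoothFunctions.eval x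
        (freeDerivation (fieldDerivations X hX) y
          (smoothFunctions.ofDual (LinearMap.toContinuousLinearMap φ))))
      (fun y z φ => by simp)
      (fun c y φ => by simp)
      (fun y φ ψ => by
        rw [← map_add, ← map_add]
        rfl)
      (fun c y φ => by
        rw [← map_smul, ← Derivation.map_smul]
        rfl)
  have key : ∀ y (φ : E →L[ℝ] ℝ), φ ((Module.evalEquiv ℝ E).symm (T y)) =
      smoothFunctions.eval x
        (freeDerivation (fieldDerivations X hX) y (smoothFunctions.ofDual φ)) := by
    intro y φ
    exact Module.apply_evalEquiv_symm_apply ℝ E (φ : Module.Dual ℝ E) (T y)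
  refine ⟨(Module.evalEquiv ℝ E).symm.toLinearMap ∘ₗ T, key, fun I hI => ?_⟩
  refine (SeparatingDual.eq_iff_forall_dual_eq (R := ℝ)).2 fun φ => ?_
  refine (key _ φ).trans ?_
  rw [freeDerivation_freeBracket_apply X hX hI]
  simp

theorem commutatorsSpan_singleton_iff {a : Fin p → ℕ} {m : ℕ} {X : Fin p → E → E} {x : E}
    {L : FreeLieAlgebra ℝ (Fin p) →ₗ[ℝ] E}
    (hL : ∀ I, I ≠ [] → L (freeBracket I) = iteratedCommutator X I x) :
    CommutatorsSpan a m X {x} ↔ (freeHead a m).map L = ⊤ := by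
  have : {v : E | ∃ I : List (Fin p), I ≠ [] ∧ weightedDegree a I ≤ m ∧
      v = iteratedCommutator X I x} =
      L '' (freeBracket '' {I | I ≠ [] ∧ weightedDegree a I ≤ m}) := by
    ext v
    constructor
    · rintro ⟨I, h1, h2, rfl⟩
      exact ⟨_, ⟨I, ⟨h1, h2⟩, rfl⟩, hL I h1⟩
    · rintro ⟨_, ⟨I, ⟨h1, h2⟩, rfl⟩, rfl⟩
      exact ⟨I, h1, h2, hL I h1⟩
  rw [freeHead, Submodule.map_span, ← this]
  constructor
  · intro h; exact h x rfl
  · intro h y hy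
    obtain rfl : y = x := hy
    exact h

/-! ### Adding one variable -/

theorem lieBracket_prodMk {V W : E → E} {f g : E → ℝ} (hV : Differentiable ℝ V)
    (hW : Differentiable ℝ W) (hf : Differentiable ℝ f) (hg : Differentiable ℝ g) (u : E × ℝ) :
    VectorField.lieBracket ℝ (fun u : E × ℝ => (V u.1, f u.1)) (fun u : E × ℝ => (W u.1, g u.1)) u =
      (VectorField.lieBracket ℝ V W u.1, fderiv ℝ g u.1 (V u.1) - fderiv ℝ f u.1 (W u.1)) := by
  have key : ∀ {V : E → E} {f : E → ℝ}, Differentiable ℝ V → Differentiable ℝ f →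
      HasFDerivAt (fun u : E × ℝ => (V u.1, f u.1))
        (((fderiv ℝ V u.1).comp (ContinuousLinearMap.fst ℝ E ℝ)).prod
          ((fderiv ℝ f u.1).comp (ContinuousLinearMap.fst ℝ E ℝ))) u := fun hV hf =>
    ((hV u.1).hasFDerivAt.comp u hasFDerivAt_fst).prodMk
      ((hf u.1).hasFDerivAt.comp u hasFDerivAt_fst)
  simp only [VectorField.lieBracket_eq]
  rw [(key hV hf).fderiv, (key hW hg).fderiv]
  simp

/-- As nothing depends on the new variable, bracketing `X_i + b_i ∂_z` with `V + g ∂_z` gives the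
last component `X_i g - V b_i`, which is the recursion of `lastLetterCoeff`. -/
theorem iteratedCommutator_prodMk (X : Fin p → E → E) (hX : ∀ i, ContDiff ℝ ∞ (X i))
    (b : Fin p → smoothFunctions E) {I : List (Fin p)} (hI : I ≠ []) :
    iteratedCommutator (fun i (u : E × ℝ) => (X i u.1, (b i : E → ℝ) u.1)) I =
      fun u => (iteratedCommutator X I u.1,
        ((∑ j, freeOperator (fieldDerivations X hX) (lastLetterCoeff j I) (b j) :
          smoothFunctions E) : E → ℝ) u.1) := by
  induction I, hI using List.nonempty_rec with
  | single i =>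
    rw [iteratedCommutator_singleton, iteratedCommutator_singleton, Finset.sum_eq_single i]
    · simp [lastLetterCoeff_singleton]
    · intro j _ hj; simp [lastLetterCoeff_singleton, hj]
    · simp
  | cons i I hI ih =>
    rw [iteratedCommutator_cons _ i hI, ih, iteratedCommutator_cons _ i hI]
    funext u
    have hc := ContDiff.iteratedCommutator hX I
    rw [lieBracket_prodMk ((hX i).differentiable (by simp)) (hc.differentiable (by simp))
      (smoothFunctions.differentiable (b i)) (smoothFunctions.differentiable _)]
    refine Prod.ext rfl ?_
    have h1 : ∀ j, freeOperator (fieldDerivations X hX) (lastLetterCoeff j (i :: I)) (b j) =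
        fieldDerivations X hX i (freeOperator (fieldDerivations X hX) (lastLetterCoeff j I) (b j)) -
          if j = i then vectorFieldDerivation _ hc (b i) else 0 := by
      intro j
      rw [lastLetterCoeff_cons j i hI, map_sub, map_mul, LinearMap.sub_apply, Module.End.mul_apply,
        freeOperator_ι]
      split_ifs with h
      · subst h
        rw [freeOperator_freeBracket _ hI, freeDerivation_freeBracket_apply X hX hI]
        rfl
      · simp
    rw [Finset.sum_congr rfl fun j _ => h1 j, Finset.sum_sub_distrib, ← map_sum,
      Finset.sum_ite_eq' Finset.univ i, if_pos (Finset.mem_univ i)]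
    rfl

/-- If a family of vector fields satisfies the spanning condition at the origin and has a
nontrivial relation, then a single variable can be added. -/
theorem exists_lift_one_variable [FiniteDimensional ℝ E] {a : Fin p → ℕ} (ha : ∀ i, 0 < a i)
    {m : ℕ} {X : Fin p → E → E} (hX : ∀ i, ContDiff ℝ ∞ (X i)) (hspan : CommutatorsSpan a m X {0})
    (hlt : Module.finrank ℝ E < Module.finrank ℝ (freeHead a m)) :
    ∃ b : Fin p → E → ℝ, (∀ i, ContDiff ℝ ∞ (b i)) ∧
      CommutatorsSpan a m (fun i (u : E × ℝ) => (X i u.1, b i u.1)) {0} := by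
  classical
  obtain ⟨κ, s, B, hs, hB⟩ := exists_freeBracket_basis p
  obtain ⟨L, hLφ, hL⟩ := exists_freeEvaluation X hX 0
  rw [commutatorsSpan_singleton_iff hL] at hspan
  have hfin := finiteDimensional_freeHead (a := a) ha
  have hm : ¬ Disjoint (freeHead a m) (LinearMap.ker L) := fun h =>
    absurd (LinearMap.finrank_le_finrank_of_injective
      (LinearMap.injective_domRestrict_iff.2 h)) (not_le.2 hlt)
  -- For the least such `t`, a relation exists in weight at most `t`, while `L` is injective up to
  -- weight `t - 1`, where the coefficients `Q j` live.
  have hex : ∃ t, ¬ Disjoint (freeHead a t) (LinearMap.ker L) := ⟨m, hm⟩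
  have htm : Nat.find hex ≤ m := Nat.find_min' hex hm
  have ht := Nat.find_spec hex
  have htmin := fun n => Nat.find_min hex (m := n)
  set t := Nat.find hex
  have ht0 : t ≠ 0 := by
    intro h
    rw [h, freeHead_zero ha] at ht
    exact ht disjoint_bot_left
  have hdisj : Disjoint (freeHead a (t - 1)) (LinearMap.ker L) := not_not.1 (htmin _ (by omega))
  obtain ⟨y, hy, hLy, hy0⟩ : ∃ y ∈ freeHead a t, L y = 0 ∧ y ≠ 0 := by
    by_contra! h
    exact ht (LinearMap.disjoint_ker.2 h)
  obtain ⟨i, hi⟩ := exists_sum_lastLetterCoeff_ne_zero ha hs hB hy0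
  have hmem := sum_lastLetterCoeff_mem ha hs hB i hy
  set Q := fun j => (B.repr y).sum fun k r => r • lastLetterCoeff j (s k) with hQ
  have hD : ∀ v : κ → ℝ, ∃ f, smoothFunctions.eval (0 : E) f = 0 ∧
      ∀ k, weightedDegree a (s k) ≤ t - 1 → smoothFunctions.eval 0
        (freeDerivation (fieldDerivations X hX) (freeBracket (s k)) f) = v k := by
    intro v
    -- A linear function already suffices: a left inverse of `L` followed by the functional with
    -- values `v` on the basis.
    obtain ⟨g, hg⟩ := LinearMap.exists_leftInverse_of_injective (L.domRestrict (freeHead a (t - 1)))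
      (LinearMap.ker_eq_bot.2 (LinearMap.injective_domRestrict_iff.2 hdisj))
    let φ : E →ₗ[ℝ] ℝ := B.constr ℝ v ∘ₗ (freeHead a (t - 1)).subtype ∘ₗ g
    refine ⟨smoothFunctions.ofDual (LinearMap.toContinuousLinearMap φ), by simp, fun k hk => ?_⟩
    rw [← hLφ]
    have hk' : freeBracket (s k) ∈ freeHead a (t - 1) :=
      Submodule.subset_span ⟨s k, ⟨hs k, hk⟩, rfl⟩
    have h1 := LinearMap.congr_fun hg ⟨_, hk'⟩
    simp only [LinearMap.comp_apply, LinearMap.domRestrict_apply, LinearMap.id_apply] at h1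
    rw [LinearMap.coe_toContinuousLinearMap']
    simp only [φ, LinearMap.comp_apply, h1, Submodule.subtype_apply]
    rw [← hB k, Module.Basis.constr_basis]
  obtain ⟨f, hf⟩ : ∃ f, smoothFunctions.eval (0 : E)
      (freeOperator (fieldDerivations X hX) (Q i) f) ≠ 0 := by
    by_contra! h
    exact hi (eq_zero_of_eval_freeOperator_eq_zero hs hB _ _ hD t _ hmem h)
  -- Changing the `i`-th field alone makes the last component of `L' y` equal to `Q i` applied to
  -- `f` at 0, which is nonzero.
  let b : Fin p → smoothFunctions E := Pi.single i f
  have hX' : ∀ j, ContDiff ℝ ∞ (fun u : E × ℝ => (X j u.1, (b j : E → ℝ) u.1)) := fun j =>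
    ((hX j).comp contDiff_fst).prodMk ((smoothFunctions.contDiff (b j)).comp contDiff_fst)
  refine ⟨fun j => (b j : E → ℝ), fun j => smoothFunctions.contDiff (b j), ?_⟩
  obtain ⟨L', -, hL'⟩ := exists_freeEvaluation
    (fun j (u : E × ℝ) => (X j u.1, (b j : E → ℝ) u.1)) hX' 0
  rw [commutatorsSpan_singleton_iff hL']
  have hfst : ∀ z, (L' z).1 = L z := by
    intro z
    have : LinearMap.fst ℝ E ℝ ∘ₗ L' = L := by
      refine B.ext fun k => ?_
      rw [LinearMap.comp_apply, hB, hL' _ (hs k), hL _ (hs k),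
        iteratedCommutator_prodMk X hX b (hs k)]
      rfl
    exact LinearMap.congr_fun this z
  have hsnd : (L' y).2 = smoothFunctions.eval (0 : E)
      (freeOperator (fieldDerivations X hX) (Q i) f) := by
    have h1 : ∀ k, (L' (B k)).2 = smoothFunctions.eval (0 : E)
        (freeOperator (fieldDerivations X hX) (lastLetterCoeff i (s k)) f) := by
      intro k
      rw [hB, hL' _ (hs k), iteratedCommutator_prodMk X hX b (hs k), Finset.sum_eq_single i]
      · simp [b]
      · intro j _ hj; simp [b, hj]
      · simp
    have h2 : (LinearMap.snd ℝ E ℝ) (L' y) = (B.repr y).sum fun k r => r * (L' (B k)).2 := by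
      conv_lhs => rw [← B.linearCombination_repr y]
      rw [Finsupp.linearCombination_apply, map_finsuppSum, map_finsuppSum]
      exact Finsupp.sum_congr fun k _ => by simp
    refine h2.trans ?_
    simp only [hQ]
    rw [map_finsuppSum, LinearMap.finsupp_sum_apply, map_finsuppSum]
    refine Finsupp.sum_congr fun k _ => ?_
    rw [h1, map_smul, LinearMap.smul_apply, map_smul, smul_eq_mul]
  have hmono : freeHead a t ≤ freeHead a m :=
    Submodule.span_mono (Set.image_mono fun I hI => ⟨hI.1, hI.2.trans htm⟩)
  refine eq_top_iff.2 fun u _ => ?_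
  obtain ⟨z, hz, hzu⟩ : u.1 ∈ (freeHead a m).map L := hspan ▸ Submodule.mem_top
  -- `L' y` is a nonzero multiple of `∂_z`, so adding a multiple of `y` corrects the last component
  -- without moving the first.
  refine ⟨z + ((u.2 - (L' z).2) / (L' y).2) • y,
    Submodule.add_mem _ hz (Submodule.smul_mem _ _ (hmono hy)), ?_⟩
  rw [map_add, map_smul]
  refine Prod.ext ?_ ?_
  · rw [Prod.fst_add, Prod.smul_fst, hfst, hfst, hLy, hzu, smul_zero, add_zero]
  · rw [Prod.snd_add, Prod.smul_snd, smul_eq_mul, div_mul_cancel₀ _ (hsnd ▸ hf), add_sub_cancel]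

end SmoothFunctions

/-! ### Adding several variables -/

section Lifting

variable {p : ℕ}

theorem iteratedCommutator_conj {E G : Type*} [NormedAddCommGroup E] [NormedSpace ℝ E]
    [NormedAddCommGroup G] [NormedSpace ℝ G] (Φ : E ≃L[ℝ] G) (X : Fin p → E → E)
    (I : List (Fin p)) :
    iteratedCommutator (fun i u => Φ (X i (Φ.symm u))) I =
      fun u => Φ (iteratedCommutator X I (Φ.symm u)) := by
  by_cases hI : I = []
  · subst hI; funext u; rw [iteratedCommutator, iteratedCommutator]; simp
  induction I, hI using List.nonempty_rec with
  | single i => rw [iteratedCommutator_singleton, iteratedCommutator_singleton]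
  | cons i I hI ih =>
    rw [iteratedCommutator_cons _ i hI, iteratedCommutator_cons _ i hI, ih]
    have key : ∀ (V : E → E) (u : G), fderiv ℝ (fun u => Φ (V (Φ.symm u))) u =
        ((Φ : E →L[ℝ] G).comp (fderiv ℝ V (Φ.symm u))).comp (Φ.symm : G →L[ℝ] E) := by
      intro V u
      have h1 := Φ.symm.comp_right_fderiv (f := fun y => Φ (V y)) (x := u)
      have h2 := Φ.comp_fderiv (f := V) (x := Φ.symm u)
      exact h1.trans (by rw [← h2]; rfl)
    funext u
    simp only [VectorField.lieBracket_eq]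
    rw [key, key]
    simp

theorem CommutatorsSpan.conj {E G : Type*} [NormedAddCommGroup E] [NormedSpace ℝ E]
    [NormedAddCommGroup G] [NormedSpace ℝ G] (Φ : E ≃L[ℝ] G) {X : Fin p → E → E} {a : Fin p → ℕ}
    {m : ℕ} (h : CommutatorsSpan a m X {0}) :
    CommutatorsSpan a m (fun i u => Φ (X i (Φ.symm u))) {0} := by
  intro u hu
  obtain rfl : u = 0 := hu
  have h0 := congrArg (Submodule.map (Φ.toLinearEquiv : E →ₗ[ℝ] G)) (h 0 rfl)
  rw [Submodule.map_span, Submodule.map_top, LinearEquiv.range] at h0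
  rw [← h0]
  congr 1
  ext v
  constructor
  · rintro ⟨I, h1, h2, rfl⟩
    refine ⟨iteratedCommutator X I 0, ⟨I, h1, h2, rfl⟩, ?_⟩
    rw [iteratedCommutator_conj]
    beta_reduce
    rw [map_zero]
    rfl
  · rintro ⟨_, ⟨I, h1, h2, rfl⟩, rfl⟩
    refine ⟨I, h1, h2, ?_⟩
    rw [iteratedCommutator_conj]
    beta_reduce
    rw [map_zero]
    rfl

theorem CommutatorsSpan.congr {E : Type*} [NormedAddCommGroup E] [NormedSpace ℝ E]
    {X Y : Fin p → E → E} {a : Fin p → ℕ} {m : ℕ} {x : E} (hXY : ∀ i, X i =ᶠ[nhds x] Y i)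
    (h : CommutatorsSpan a m X {x}) : CommutatorsSpan a m Y {x} := by
  intro u hu
  obtain rfl : u = x := hu
  rw [← h u rfl]
  congr 1
  ext v
  refine exists_congr fun I => and_congr_right fun _ => and_congr_right fun _ => ?_
  rw [(Filter.EventuallyEq.iteratedCommutator hXY I).eq_of_nhds]

/-- The space is quantified inside the induction because it grows from `E` to `E × ℝ` at each step.
-/
theorem exists_lift {a : Fin p → ℕ} (ha : ∀ i, 0 < a i) {m : ℕ} (k : ℕ) :
    ∀ (E : Type) [NormedAddCommGroup E] [NormedSpace ℝ E] [FiniteDimensional ℝ E]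
      (X : Fin p → E → E), (∀ i, ContDiff ℝ ∞ (X i)) → CommutatorsSpan a m X {0} →
      Module.finrank ℝ E + k = Module.finrank ℝ (freeHead a m) →
      ∃ b : Fin p → E × EuclideanSpace ℝ (Fin k) → EuclideanSpace ℝ (Fin k),
        (∀ i, ContDiff ℝ ∞ (b i)) ∧ CommutatorsSpan a m (fun i u => (X i u.1, b i u)) {0} := by
  induction k with
  | zero =>
    intro E _ _ _ X _ hspan _
    let Φ : E ≃L[ℝ] E × EuclideanSpace ℝ (Fin 0) :=
      ContinuousLinearEquiv.equivOfInverse (ContinuousLinearMap.inl ℝ E _)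
        (ContinuousLinearMap.fst ℝ E _) (fun _ => rfl)
        (fun u => Prod.ext rfl (Subsingleton.elim _ _))
    exact ⟨fun _ _ => 0, fun _ => contDiff_const, hspan.conj Φ⟩
  | succ k ih =>
    intro E _ _ _ X hX hspan hdim
    obtain ⟨b, hb, hspan₁⟩ := exists_lift_one_variable ha hX hspan (by omega)
    obtain ⟨c, hc, hspan₂⟩ := ih (E × ℝ) (fun i u => (X i u.1, b i u.1))
      (fun i => ((hX i).comp contDiff_fst).prodMk ((hb i).comp contDiff_fst)) hspan₁
      (by rw [Module.finrank_prod, Module.finrank_self]; omega)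
    -- Any linear identification will do: it only changes coordinates among the added variables and
    -- leaves the component `X i u.1` intact.
    have e : (ℝ × EuclideanSpace ℝ (Fin k)) ≃L[ℝ] EuclideanSpace ℝ (Fin (k + 1)) :=
      ContinuousLinearEquiv.ofFinrankEq (by simp [add_comm])
    let Φ : ((E × ℝ) × EuclideanSpace ℝ (Fin k)) ≃L[ℝ] E × EuclideanSpace ℝ (Fin (k + 1)) :=
      (ContinuousLinearEquiv.prodAssoc ℝ E ℝ (EuclideanSpace ℝ (Fin k))).trans
        ((ContinuousLinearEquiv.refl ℝ E).prodCongr e)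
    refine ⟨fun i u => e (b i u.1, c i (Φ.symm u)), fun i => ?_, hspan₂.conj Φ⟩
    exact e.contDiff.comp (((hb i).comp contDiff_fst).prodMk ((hc i).comp Φ.symm.contDiff))

/-- Multiplication by a bump function supported in `O` makes the fields global, so that they act on
the algebra of smooth functions on all of `E`. -/
theorem exists_contDiff_eventuallyEq {E : Type*} [NormedAddCommGroup E] [NormedSpace ℝ E]
    [HasContDiffBump E] [FiniteDimensional ℝ E] {G : Type*} [NormedAddCommGroup G]
    [NormedSpace ℝ G] {f : E → G} {O : Set E} (hO : IsOpen O) {x : E} (hx : x ∈ O)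
    (hf : ContDiffOn ℝ ∞ f O) : ∃ g : E → G, ContDiff ℝ ∞ g ∧ g =ᶠ[nhds x] f := by
  obtain ⟨r, hr, hrO⟩ := Metric.nhds_basis_closedBall.mem_iff.1 (hO.mem_nhds hx)
  let χ : ContDiffBump x := ⟨r / 2, r, half_pos hr, half_lt_self hr⟩
  refine ⟨fun y => χ y • f y, contDiff_iff_contDiffAt.2 fun y => ?_, ?_⟩
  · by_cases hy : y ∈ O
    · exact χ.contDiff.contDiffAt.smul (hf.contDiffAt (hO.mem_nhds hy))
    · have h1 : y ∉ tsupport χ := fun h => hy (hrO (χ.tsupport_eq ▸ h))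
      have h2 : (fun y => χ y • f y) =ᶠ[nhds y] fun _ => 0 := by
        filter_upwards [notMem_tsupport_iff_eventuallyEq.1 h1] with z hz
        rw [hz, Pi.zero_apply, zero_smul]
      exact contDiffAt_const.congr_of_eventuallyEq h2
  · filter_upwards [χ.eventuallyEq_one] with z hz
    rw [hz, Pi.one_apply, one_smul]

/-- The spanning condition at a point extends to a neighborhood. -/
theorem CommutatorsSpan.exists_isOpen {E : Type*} [NormedAddCommGroup E] [NormedSpace ℝ E]
    [FiniteDimensional ℝ E] {X : Fin p → E → E} {O : Set E} (hO : IsOpen O)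
    (hX : ∀ i, ContDiffOn ℝ ∞ (X i) O) {a : Fin p → ℕ} {m : ℕ} {x : E} (hx : x ∈ O)
    (h : CommutatorsSpan a m X {x}) :
    ∃ U ⊆ O, IsOpen U ∧ x ∈ U ∧ CommutatorsSpan a m X U := by
  obtain ⟨κ, f, -, hspan, hli⟩ := exists_linearIndependent' ℝ
    fun I : {I : List (Fin p) // I ≠ [] ∧ weightedDegree a I ≤ m} => iteratedCommutator X I.1 x
  have htop : Submodule.span ℝ (Set.range fun I : {I : List (Fin p) //
      I ≠ [] ∧ weightedDegree a I ≤ m} => iteratedCommutator X I.1 x) = ⊤ := by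
    rw [← h x rfl]
    congr 1
    ext v
    constructor
    · rintro ⟨⟨I, h1, h2⟩, rfl⟩; exact ⟨I, h1, h2, rfl⟩
    · rintro ⟨I, h1, h2, rfl⟩; exact ⟨⟨I, h1, h2⟩, rfl⟩
  rw [htop] at hspan
  have := hli.finite
  have := Fintype.ofFinite κ
  have hcard : Fintype.card κ = Module.finrank ℝ E :=
    (Module.finrank_eq_card_basis (Module.Basis.mk hli hspan.ge)).symm
  let g : E → κ → E := fun u k => iteratedCommutator X (f k).1 u
  have hg : ContinuousOn g O := continuousOn_pi.2 fun k =>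
    (ContDiffOn.iteratedCommutator hO hX (f k).1).continuousOn
  -- The chosen commutators form a basis at `x`. Wherever they stay independent they still span,
  -- their number being the dimension.
  refine ⟨O ∩ g ⁻¹' {v | LinearIndependent ℝ v}, Set.inter_subset_left,
    hg.isOpen_inter_preimage hO isOpen_setOfPred_linearIndependent, ⟨hx, hli⟩, ?_⟩
  rintro u ⟨-, hu⟩
  have hu' : LinearIndependent ℝ (g u) := hu
  rw [eq_top_iff, ← hu'.span_eq_top_of_card_eq_finrank' hcard]
  refine Submodule.span_mono ?_
  rintro _ ⟨k, rfl⟩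
  exact ⟨(f k).1, (f k).2.1, (f k).2.2, rfl⟩

end Lifting

theorem proposition6p1 {n p : ℕ} (a : Fin p → ℕ) (ha : ∀ i, 0 < a i)
    (m : ℕ) (hm : ∀ i, a i ≤ m)
    (O : Set (EuclideanSpace ℝ (Fin n))) (hO : IsOpen O) (h0 : (0 : EuclideanSpace ℝ (Fin n)) ∈ O)
    (X : Fin p → EuclideanSpace ℝ (Fin n) → EuclideanSpace ℝ (Fin n))
    (hX : ∀ i, ContDiffOn ℝ ∞ (X i) O)
    (hspan : CommutatorsSpan a m X O)
    (d : ℕ) (hd : d = Module.finrank ℝ (RelFreeNilpotent a m)) :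
    n ≤ d ∧
    ∃ U : Set (EuclideanSpace ℝ (Fin n) × EuclideanSpace ℝ (Fin (d - n))),
      IsOpen U ∧ 0 ∈ U ∧ (∀ u ∈ U, u.1 ∈ O) ∧
      ∃ b : Fin p → EuclideanSpace ℝ (Fin n) × EuclideanSpace ℝ (Fin (d - n)) →
          EuclideanSpace ℝ (Fin (d - n)),
        (∀ i, ContDiffOn ℝ ∞ (b i) U) ∧
        IsFreeVectorFields a m (fun i u => (X i u.1, b i u)) U := by
  choose Y hY hYX using fun i => exists_contDiff_eventuallyEq hO h0 (hX i)
  have hspanY : CommutatorsSpan a m Y {0} :=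
    CommutatorsSpan.congr (fun i => (hYX i).symm) fun x hx => by
      obtain rfl : x = 0 := hx
      exact hspan _ h0
  rw [finrank_relFreeNilpotent] at hd
  have hnd : n ≤ d := by
    obtain ⟨L, -, hL⟩ := exists_freeEvaluation Y hY 0
    have hmap := (commutatorsSpan_singleton_iff hL).1 hspanY
    have := finiteDimensional_freeHead ha m
    have h1 := Submodule.finrank_map_le L (freeHead a m)
    rwa [hmap, finrank_top, finrank_euclideanSpace_fin, ← hd] at h1
  refine ⟨hnd, ?_⟩
  obtain ⟨b, hb, hbspan⟩ := exists_lift ha (d - n) (EuclideanSpace ℝ (Fin n)) Y hY hspanY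
    (by rw [finrank_euclideanSpace_fin, ← hd]; omega)
  -- The original fields can be put back, since they agree with the cut-off ones near the origin.
  have hspan0 : CommutatorsSpan a m (fun i u => (X i u.1, b i u)) {0} := by
    refine CommutatorsSpan.congr (fun i => ?_) hbspan
    have h1 : Filter.Tendsto Prod.fst
        (nhds (0 : EuclideanSpace ℝ (Fin n) × EuclideanSpace ℝ (Fin (d - n)))) (nhds 0) :=
      continuous_fst.tendsto' _ _ rfl
    filter_upwards [h1.eventually (hYX i)] with u hu
    rw [hu]
  have hsmooth : ∀ i, ContDiffOn ℝ ∞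
      (fun u : EuclideanSpace ℝ (Fin n) × EuclideanSpace ℝ (Fin (d - n)) => (X i u.1, b i u))
      (Prod.fst ⁻¹' O) := fun i =>
    ((hX i).comp contDiff_fst.contDiffOn fun _ hu => hu).prodMk (hb i).contDiffOn
  obtain ⟨U, hUO, hU, h0U, hUspan⟩ := CommutatorsSpan.exists_isOpen
    (hO.preimage continuous_fst) hsmooth (x := 0) h0 hspan0
  refine ⟨U, hU, h0U, fun u hu => hUO hu, b, fun i => (hb i).contDiffOn, ?_⟩
  exact
    { isOpen := hU
      smooth := fun i => (hsmooth i).mono hUO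
      finrank_eq := by
        rw [finrank_relFreeNilpotent, ← hd, Module.finrank_prod, finrank_euclideanSpace_fin,
          finrank_euclideanSpace_fin]
        omega
      span := hUspan }
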